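/- For $x\in\mathbb{R}^n$ let $\|x\|_1=\sum_i|x_i|$, and for an integer $k\ge 0$ let $\|x\|_{k,1}$ be the sum of the $k$ largest of the numbers $|x_1|,\dots,|x_n|$ (of all of them if $k\ge n$). For $F\in\mathbb{R}^{n\times m}$ let $\sigma_k(F)\ge 0$ and $L(F)\ge 0$ be defined by $$\sigma_k^2(F)=\max_{u\in\{0,1\}^{2n},\ \mathbf 1^Tu\le k} u^T\left(\begin{pmatrix}1&-1\\-1&1\end{pmatrix}\otimes FF^T\right)u,\qquad L^2(F)=\max_{v\in\{-1,1\}^n}v^TFF^Tv .$$ There is an absolute constant $c>0$ such that the following holds for all integers $n,m,k\ge 0$, every $F\in\mathbb{R}^{n\times m}$ and all real numbers $\alpha_k\ge 0$, $\beta>0$, $\Delta>0$. Let $y$ be a random vector in $\mathbb{R}^m$ whose coordinates are independent, with $\|y\|_\infty\le\Delta$ almost surely. If $$\mathbf{E}\big[\|Fy\|_{k,1}\big]+\beta\,\sigma_k(F)\ \le\ \big(\mathbf{E}\big[\|Fy\|_1\big]-\beta L(F)\big)\,\alpha_k ,$$ then $$\mathbf{Prob}\big[\,\|Fy\|_{k,1}\le\alpha_k\|Fy\|_1\,\big]\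 \ge\ 1-2c\,e^{-\beta^2/(c\Delta^2)} .$$ -/

import Mathlib

open MeasureTheory ProbabilityTheory
open scoped Matrix Kronecker

noncomputable section

/-- The `ℓ¹` norm of a vector. -/
def l1Norm {n : ℕ} (x : Fin n → ℝ) : ℝ := ∑ i, |x i|

/-- `‖x‖_{k,1}`: the sum of the magnitudes of the `k` largest coefficients of `x`, i.e. the largest
value of `∑ i ∈ S, |x i|` over index sets `S` with at most `k` elements. The maximum is over a
finite nonempty family. -/
def topNorm {n : ℕ} (k : ℕ) (x : Fin n → ℝ) : ℝ :=
  ⨆ S : {S : Finset (Fin n) // S.card ≤ k}, ∑ i ∈ S.1, |x i|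

/-- The values of the quadratic form `uᵀ ([[1, -1], [-1, 1]] ⊗ F Fᵀ) u` over the vectors
`u ∈ {0,1}^{2n}` with `1ᵀ u ≤ k`. -/
def sigmaValues {n m : ℕ} (k : ℕ) (F : Matrix (Fin n) (Fin m) ℝ) : Set ℝ :=
  {q | ∃ u : Fin 2 × Fin n → ℝ, (∀ p, u p = 0 ∨ u p = 1) ∧ ∑ p, u p ≤ (k : ℝ) ∧
    q = u ⬝ᵥ ((!![(1 : ℝ), -1; -1, 1] ⊗ₖ (F * Fᵀ)) *ᵥ u)}

/-- `σ_k(F)`: the square root of the maximum of the finite nonempty set `sigmaValues k F`. -/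
def sigma {n m : ℕ} (k : ℕ) (F : Matrix (Fin n) (Fin m) ℝ) : ℝ :=
  Real.sqrt (sSup (sigmaValues k F))

/-- The values of the quadratic form `vᵀ F Fᵀ v` over the sign vectors `v ∈ {-1,1}^n`. -/
def cutValues {n m : ℕ} (F : Matrix (Fin n) (Fin m) ℝ) : Set ℝ :=
  {q | ∃ v : Fin n → ℝ, (∀ i, v i = -1 ∨ v i = 1) ∧ q = v ⬝ᵥ ((F * Fᵀ) *ᵥ v)}

/-- `L(F)`: the square root of the maximum of the finite nonempty set `cutValues F`. -/
def cutConst {n m : ℕ} (F : Matrix (Fin n) (Fin m) ℝ) : ℝ :=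
  Real.sqrt (sSup (cutValues F))

end

/-!
Each of `‖F y‖_{k,1}` and `‖F y‖₁` is a maximum of linear forms `⟨Fᵀ w, y⟩` over sign vectors `w`,
hence a convex function of `y`, with Euclidean Lipschitz constant at most `σ_k(F)`, respectively
`L(F)` (`topNorm_mulVec_le`, `l1Norm_mulVec_le`). If both tails of such a function around its mean
are sub-Gaussian, then outside an event of probability at most `2 e^{-β²/(c Δ²)}` one has
`‖F y‖_{k,1} ≤ E ‖F y‖_{k,1} + β σ_k(F) ≤ α (E ‖F y‖₁ - β L(F)) ≤ α ‖F y‖₁`.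

The concentration comes from Maurey's convex infimum-convolution inequality
(`integral_exp_mul_integral_exp_neg_le_one`): if `f` is convex and
`g(x) ≤ f(z) + γ |x - z|²` for all `x`, `z`, with `γ` of order `Δ⁻²`, then `E e^g · E e^{-f} ≤ 1`.
In dimension one it follows from the two-point inequality
`e^{g(x) - f(y)} + e^{g(y) - f(x)} ≤ 2`. It passes to products by induction, because the infimal
convolution of `f` along one coordinate is still jointly convex (`convexOn_lineInfConv`) and
log-integrals of exponentials preserve convexity (`convexOn_log_integral_exp`).

For an `L`-Lipschitz convex `f` one takes `λ f` and `g = λ f - 8 λ² L² Δ²`, and bounds `E e^{-λ f}`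
from below by Jensen's inequality. As the resulting bound is symmetric in the sign of `λ`, it
controls the upper and the lower tail, with deviations measured directly from the mean.
-/

/-! ### Integrals of exponentials of Lipschitz families -/

theorem Continuous.integrable_of_ae_mem_isCompact {E : Type*} [TopologicalSpace E] [T2Space E]
    [MeasurableSpace E] [OpensMeasurableSpace E] [SecondCountableTopology E]
    {μ : Measure E} [IsFiniteMeasure μ] {s : Set E} (hs : IsCompact s) (hμ : ∀ᵐ x ∂μ, x ∈ s)
    {f : E → ℝ} (hf : Continuous f) : Integrable f μ := by
  obtain ⟨C, hC⟩ := hs.exists_bound_of_continuousOn hf.continuousOn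
  exact Integrable.of_bound hf.measurable.aestronglyMeasurable C (hμ.mono fun x hx => hC x hx)

/-- If `u ≤ v + C` pointwise then the log-integrals of the exponentials compare in the same way. -/
theorem log_integral_exp_le {α : Type*} [MeasurableSpace α] {μ : Measure α} [NeZero μ]
    {u v : α → ℝ} {C : ℝ} (hu : Integrable (fun t => Real.exp (u t)) μ)
    (hv : Integrable (fun t => Real.exp (v t)) μ) (huv : ∀ t, u t ≤ v t + C) :
    Real.log (∫ t, Real.exp (u t) ∂μ) ≤ Real.log (∫ t, Real.exp (v t) ∂μ) + C := by
  have hv0 := integral_exp_pos hv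
  rw [← Real.log_exp C, ← Real.log_mul hv0.ne' (Real.exp_pos _).ne', ← integral_mul_const]
  refine Real.log_le_log (integral_exp_pos hu) (integral_mono hu (hv.mul_const _) fun t => ?_)
  simpa only [← Real.exp_add] using Real.exp_le_exp.2 (huv t)

theorem lipschitzWith_log_integral_exp {α E : Type*} [MeasurableSpace α] [PseudoMetricSpace E]
    {μ : Measure α} [NeZero μ] {K : NNReal} {u : E → α → ℝ}
    (hu : ∀ z, Integrable (fun t => Real.exp (u z t)) μ)
    (hK : ∀ t, LipschitzWith K fun z => u z t) :
    LipschitzWith K fun z => Real.log (∫ t, Real.exp (u z t) ∂μ) :=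
  LipschitzWith.of_le_add_mul K fun z w =>
    log_integral_exp_le (hu z) (hu w) fun t => (hK t).le_add_mul z w

/-- Log-integrals of exponentials of a convex family form a convex function (Hölder's inequality,
obtained here from convexity of `exp` after normalising both integrals to `1`). -/
theorem convexOn_log_integral_exp {α E : Type*} [MeasurableSpace α] [AddCommGroup E] [Module ℝ E]
    {μ : Measure α} [NeZero μ] {u : E → α → ℝ}
    (hu : ∀ z, Integrable (fun t => Real.exp (u z t)) μ)
    (hc : ∀ t, ConvexOn ℝ Set.univ fun z => u z t) :
    ConvexOn ℝ Set.univ fun z => Real.log (∫ t, Real.exp (u z t) ∂μ) := by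
  refine ⟨convex_univ, fun x _ y _ a b ha hb hab => ?_⟩
  have hX := integral_exp_pos (hu x)
  have hY := integral_exp_pos (hu y)
  set X := ∫ t, Real.exp (u x t) ∂μ
  set Y := ∫ t, Real.exp (u y t) ∂μ
  simp only [smul_eq_mul]
  rw [Real.log_le_iff_le_exp (integral_exp_pos (hu _))]
  have hpt : ∀ t, Real.exp (u (a • x + b • y) t) ≤
      Real.exp (a * Real.log X + b * Real.log Y) *
        (a * (Real.exp (u x t) / X) + b * (Real.exp (u y t) / Y)) := fun t => by
    have h1 := (hc t).2 (Set.mem_univ x) (Set.mem_univ y) ha hb hab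
    have h2 := convexOn_exp.2 (Set.mem_univ (u x t - Real.log X))
      (Set.mem_univ (u y t - Real.log Y)) ha hb hab
    simp only [smul_eq_mul, Real.exp_sub, Real.exp_log hX, Real.exp_log hY] at h1 h2
    calc Real.exp (u (a • x + b • y) t)
        ≤ Real.exp ((a * Real.log X + b * Real.log Y) +
            (a * (u x t - Real.log X) + b * (u y t - Real.log Y))) :=
          Real.exp_le_exp.2 (by linarith)
      _ ≤ _ := by
          rw [Real.exp_add]
          exact mul_le_mul_of_nonneg_left h2 (Real.exp_pos _).le
  have hix : Integrable (fun t => a * (Real.exp (u x t) / X)) μ := ((hu x).div_const _).const_mul _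
  have hiy : Integrable (fun t => b * (Real.exp (u y t) / Y)) μ := ((hu y).div_const _).const_mul _
  refine (integral_mono (hu _) ((hix.add hiy).const_mul _) hpt).trans_eq ?_
  simp only [Pi.add_apply]
  rw [integral_const_mul, integral_add hix hiy, integral_const_mul, integral_const_mul,
    integral_div, integral_div, div_self hX.ne', div_self hY.ne', mul_one, mul_one, hab, mul_one]

/-! ### Infimal convolution along a line -/

/-- The infimal convolution of `f` with the quadratic cost `γ s²` in the direction `e`. -/
noncomputable def lineInfConv {E : Type*} [AddCommGroup E] [Module ℝ E] (γ : ℝ) (e : E)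
    (f : E → ℝ) (p : E) : ℝ :=
  ⨅ s : ℝ, (f (p + s • e) + γ * s ^ 2)

section lineInfConv

variable {E : Type*} [NormedAddCommGroup E] [NormedSpace ℝ E] {γ : ℝ} {e : E} {f : E → ℝ}
  {K : NNReal}

theorem bddBelow_lineInfConv (hγ : 0 < γ) (hf : LipschitzWith K f) (p : E) :
    BddBelow (Set.range fun s : ℝ => f (p + s • e) + γ * s ^ 2) := by
  refine ⟨f p - (K * ‖e‖) ^ 2 / (4 * γ), ?_⟩
  rintro _ ⟨s, rfl⟩
  have h := hf.le_add_mul p (p + s • e)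
  rw [dist_self_add_right, norm_smul, Real.norm_eq_abs] at h
  have h2 : K * ‖e‖ * |s| ≤ γ * s ^ 2 + (K * ‖e‖) ^ 2 / (4 * γ) := by
    rw [← sq_abs s, ← sub_nonneg]
    have : γ * |s| ^ 2 + (K * ‖e‖) ^ 2 / (4 * γ) - K * ‖e‖ * |s|
        = (2 * γ * |s| - K * ‖e‖) ^ 2 / (4 * γ) := by field_simp; ring
    rw [this]; positivity
  dsimp only
  linarith

theorem lineInfConv_le (hγ : 0 < γ) (hf : LipschitzWith K f) (p : E) (s : ℝ) :
    lineInfConv γ e f p ≤ f (p + s • e) + γ * s ^ 2 :=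
  ciInf_le (bddBelow_lineInfConv hγ hf p) s

theorem lipschitzWith_lineInfConv (hγ : 0 < γ) (hf : LipschitzWith K f) :
    LipschitzWith K (lineInfConv γ e f) :=
  LipschitzWith.of_le_add_mul K fun p q => by
    rw [← sub_le_iff_le_add]
    refine le_ciInf fun s => ?_
    have h1 := lineInfConv_le (e := e) hγ hf p s
    have h2 := hf.le_add_mul (p + s • e) (q + s • e)
    rw [dist_add_right] at h2
    linarith

theorem convexOn_lineInfConv (hγ : 0 < γ) (hf : LipschitzWith K f) (hc : ConvexOn ℝ Set.univ f) :
    ConvexOn ℝ Set.univ (lineInfConv γ e f) := by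
  refine ⟨convex_univ, fun p _ q _ a b ha hb hab => ?_⟩
  refine le_of_forall_pos_le_add fun ε hε => ?_
  obtain ⟨s, hs⟩ := exists_lt_of_ciInf_lt (lt_add_of_pos_right (lineInfConv γ e f p) hε)
  obtain ⟨t, ht⟩ := exists_lt_of_ciInf_lt (lt_add_of_pos_right (lineInfConv γ e f q) hε)
  have h1 := lineInfConv_le (e := e) hγ hf (a • p + b • q) (a * s + b * t)
  have h2 := hc.2 (Set.mem_univ (p + s • e)) (Set.mem_univ (q + t • e)) ha hb hab
  have h3 : a • (p + s • e) + b • (q + t • e) = a • p + b • q + (a * s + b * t) • e := by module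
  have h4 := (even_two.convexOn_pow (𝕜 := ℝ)).2 (Set.mem_univ s) (Set.mem_univ t) ha hb hab
  rw [h3] at h2
  simp only [smul_eq_mul] at h2 h4 ⊢
  have h5 := mul_le_mul_of_nonneg_left hs.le ha
  have h6 := mul_le_mul_of_nonneg_left ht.le hb
  have h7 := mul_le_mul_of_nonneg_left h4 hγ.le
  have h8 : a * ε + b * ε = ε := by rw [← add_mul, hab, one_mul]
  linarith

end lineInfConv

/-! ### The convex infimum-convolution inequality -/

theorem exp_add_exp_neg_le_two {d s : ℝ} (hd : 0 ≤ d) (hd' : d ≤ 1 / 4) (hs : s ≤ d - 2 * d ^ 2) :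
    Real.exp s + Real.exp (-d) ≤ 2 := by
  have h1 : Real.exp s ≤ 1 + (d - 2 * d ^ 2) + (d - 2 * d ^ 2) ^ 2 := by
    have hb : |d - 2 * d ^ 2| ≤ 1 := abs_le.2 ⟨by nlinarith, by nlinarith⟩
    have := (abs_le.1 (Real.abs_exp_sub_one_sub_id_le hb)).2
    linarith [Real.exp_le_exp.2 hs]
  have h2 : Real.exp (-d) ≤ 1 - d + d ^ 2 := by
    have hb : |-d| ≤ 1 := abs_le.2 ⟨by linarith, by linarith⟩
    have := (abs_le.1 (Real.abs_exp_sub_one_sub_id_le hb)).2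
    nlinarith
  nlinarith [mul_nonneg hd hd, pow_nonneg hd 3]

/-- The two-point form of the one-dimensional inequality: the larger of the values `f x`, `f y` is
lowered by moving along the segment towards the other point, at a cost of at most `1 / 8`. -/
theorem exp_sub_add_exp_sub_le_two {γ : ℝ} {f g : ℝ → ℝ} (hc : ConvexOn ℝ Set.univ f)
    (hgf : ∀ x z, g x ≤ f z + γ * (x - z) ^ 2) {x y : ℝ} (hxy : γ * (x - y) ^ 2 ≤ 1 / 8) :
    Real.exp (g x - f y) + Real.exp (g y - f x) ≤ 2 := by
  wlog h : f y ≤ f x generalizing x y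
  · rw [add_comm]
    exact this (by rwa [← neg_sub, neg_sq]) (le_of_not_ge h)
  set d := f x - f y with hd
  have hgy : g y - f x ≤ -d := by have := hgf y y; simp at this; linarith
  have hθ : ∀ θ : ℝ, 0 ≤ θ → θ ≤ 1 → g x - f y ≤ (1 - θ) * d + θ ^ 2 / 8 := fun θ h0 h1 => by
    have h2 := hgf x ((1 - θ) • x + θ • y)
    have h3 := hc.2 (Set.mem_univ x) (Set.mem_univ y) (sub_nonneg.2 h1) h0 (by ring)
    simp only [smul_eq_mul] at h2 h3
    have h4 : γ * (x - ((1 - θ) * x + θ * y)) ^ 2 = θ ^ 2 * (γ * (x - y) ^ 2) := by ring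
    have h5 := mul_le_mul_of_nonneg_left hxy (sq_nonneg θ)
    rw [hd]
    linarith
  -- The bound is smallest at `θ = 4 d`, or at `θ = 1` when `4 d` is beyond the end of the segment.
  rcases le_total d (1 / 4) with hd4 | hd4
  · have := hθ (4 * d) (by linarith) (by linarith)
    refine le_trans (add_le_add_right (Real.exp_le_exp.2 hgy) _) ?_
    exact exp_add_exp_neg_le_two (by linarith) hd4 (by linarith)
  · have := hθ 1 zero_le_one le_rfl
    have h1 := Real.exp_le_exp.2 (show g x - f y ≤ 1 / 8 by linarith)
    have h2 := Real.exp_le_exp.2 (show g y - f x ≤ -(1 / 4) by linarith)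
    exact (add_le_add h1 h2).trans
      (exp_add_exp_neg_le_two (d := 1 / 4) (by norm_num) le_rfl (by norm_num))

/-- The one-dimensional case: integrate the two-point inequality over both points. -/
theorem integral_exp_mul_integral_exp_neg_le_one_real {γ Δ : ℝ} (hγ0 : 0 ≤ γ)
    (hγ : γ * (2 * Δ) ^ 2 ≤ 1 / 8) (μ : Measure ℝ) [IsProbabilityMeasure μ]
    (hμ : ∀ᵐ t ∂μ, |t| ≤ Δ) {f g : ℝ → ℝ} (hc : ConvexOn ℝ Set.univ f)
    (hgf : ∀ x z, g x ≤ f z + γ * (x - z) ^ 2)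
    (hig : Integrable (fun t => Real.exp (g t)) μ)
    (hif : Integrable (fun t => Real.exp (-f t)) μ) :
    (∫ t, Real.exp (g t) ∂μ) * ∫ t, Real.exp (-f t) ∂μ ≤ 1 := by
  set A := ∫ t, Real.exp (g t) ∂μ with hA
  set B := ∫ t, Real.exp (-f t) ∂μ with hB
  have hpt : ∀ x y : ℝ, |x| ≤ Δ → |y| ≤ Δ →
      Real.exp (g x) * Real.exp (-f y) + Real.exp (g y) * Real.exp (-f x) ≤ 2 := by
    intro x y hx hy
    have hxy : γ * (x - y) ^ 2 ≤ 1 / 8 := by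
      refine le_trans (mul_le_mul_of_nonneg_left ?_ hγ0) hγ
      have h := sq_le_sq' (a := x - y) (b := 2 * Δ) (by linarith [(abs_le.1 hx).1, (abs_le.1 hy).2])
        (by linarith [(abs_le.1 hx).2, (abs_le.1 hy).1])
      exact h
    simpa only [← Real.exp_add, ← sub_eq_add_neg] using exp_sub_add_exp_sub_le_two hc hgf hxy
  have h1 : ∀ᵐ x ∂μ, Real.exp (g x) * B + A * Real.exp (-f x) ≤ 2 := by
    filter_upwards [hμ] with x hx
    rw [hA, hB, ← integral_const_mul, ← integral_mul_const,
      ← integral_add (hif.const_mul _) (hig.mul_const _)]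
    refine (integral_mono_ae ((hif.const_mul _).add (hig.mul_const _)) (integrable_const 2)
      (hμ.mono fun y hy => hpt x y hx hy)).trans_eq (by simp)
  have h2 := integral_mono_ae ((hig.mul_const B).add (hif.const_mul A)) (integrable_const 2) h1
  simp only [Pi.add_apply] at h2
  rw [integral_add (hig.mul_const B) (hif.const_mul A), integral_mul_const, integral_const_mul] at h2
  simp only [integral_const, probReal_univ, one_smul] at h2
  linarith

theorem ae_pi_mem_pi_Icc {n : ℕ} {Δ : ℝ} (μ : Fin n → Measure ℝ)
    [∀ i, IsProbabilityMeasure (μ i)] (hμ : ∀ i, ∀ᵐ t ∂μ i, |t| ≤ Δ) :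
    ∀ᵐ x ∂Measure.pi μ, x ∈ Set.univ.pi fun _ : Fin n => Set.Icc (-Δ) Δ := by
  have : ∀ i, ∀ᵐ x ∂Measure.pi μ, |x i| ≤ Δ := fun i =>
    (measurePreserving_eval μ i).quasiMeasurePreserving.ae (hμ i)
  filter_upwards [ae_all_iff.2 this] with x hx i _ using abs_le.1 (hx i)

/-- Maurey's inequality: if `g` lies below the infimal convolution of the convex function `f` with
the quadratic cost `γ |x - z|²`, then `E e^g · E e^{-f} ≤ 1` under every product of probability
measures supported in `[-Δ, Δ]`, provided `γ` is small compared with `Δ⁻²`. -/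
theorem integral_exp_mul_integral_exp_neg_le_one {γ Δ : ℝ} (hγ0 : 0 < γ)
    (hγ : γ * (2 * Δ) ^ 2 ≤ 1 / 8) (n : ℕ) (μ : Fin n → Measure ℝ)
    [∀ i, IsProbabilityMeasure (μ i)] (hμ : ∀ i, ∀ᵐ t ∂μ i, |t| ≤ Δ) {K K' : NNReal}
    {f g : (Fin n → ℝ) → ℝ} (hc : ConvexOn ℝ Set.univ f) (hf : LipschitzWith K f)
    (hg : LipschitzWith K' g) (hgf : ∀ x z, g x ≤ f z + γ * ∑ i, (x i - z i) ^ 2) :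
    (∫ x, Real.exp (g x) ∂Measure.pi μ) * ∫ x, Real.exp (-f x) ∂Measure.pi μ ≤ 1 := by
  induction n generalizing K K' with
  | zero =>
    have := hgf 0 0
    simp only [Finset.univ_eq_empty, Finset.sum_empty, mul_zero, add_zero] at this
    simp only [Measure.pi_of_empty μ 0, integral_dirac, ← Real.exp_add]
    simpa using this
  | succ n ih =>
    set e : Fin (n + 1) → ℝ := Pi.single 0 1 with he
    set h := lineInfConv γ e f
    have hhL : LipschitzWith K h := lipschitzWith_lineInfConv hγ0 hf
    have hhc : ConvexOn ℝ Set.univ h := convexOn_lineInfConv hγ0 hf hc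
    -- Integration over the first coordinate `t`, then over the remaining ones `z`.
    have hcomm : ∀ F : (Fin (n + 1) → ℝ) → ℝ, Continuous F →
        ∫ x, F x ∂Measure.pi μ
          = ∫ z, ∫ t, F (Fin.cons t z) ∂μ 0 ∂Measure.pi (fun i : Fin n => μ i.succ) ∧
        Integrable (fun z => ∫ t, F (Fin.cons t z) ∂μ 0)
          (Measure.pi (fun i : Fin n => μ i.succ)) := by
      intro F hF
      have hI : Integrable F (Measure.pi μ) := hF.integrable_of_ae_mem_isCompact
        (isCompact_univ_pi fun _ => isCompact_Icc) (ae_pi_mem_pi_Icc μ hμ)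
      have hmp := (measurePreserving_piFinSuccAbove μ 0).symm
      have hI2 := (hmp.integrable_comp_emb (MeasurableEquiv.measurableEmbedding _)).2 hI
      have hfun : ∀ p : ℝ × (Fin n → ℝ),
          (MeasurableEquiv.piFinSuccAbove (fun _ : Fin (n + 1) => ℝ) 0).symm p
            = Fin.cons p.1 p.2 := fun p => by
        simp [MeasurableEquiv.piFinSuccAbove, Fin.insertNthEquiv]
      rw [← hmp.integral_comp (MeasurableEquiv.measurableEmbedding _)]
      constructor
      · refine (integral_prod_symm _ hI2).trans ?_
        simp only [Function.comp_apply, hfun, Fin.zero_succAbove]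
      · have := hI2.integral_prod_right
        simpa only [Function.comp_apply, hfun, Fin.zero_succAbove] using this
    have hL0 : ∀ z : Fin n → ℝ, Continuous fun t : ℝ => (Fin.cons t z : Fin (n + 1) → ℝ) := by
      intro z; fun_prop
    have hL1 : ∀ t : ℝ, LipschitzWith 1 fun z : Fin n → ℝ => (Fin.cons t z : Fin (n + 1) → ℝ) := by
      refine fun t => LipschitzWith.of_dist_le_mul fun z w => ?_
      rw [NNReal.coe_one, one_mul, dist_pi_le_iff dist_nonneg]
      exact Fin.cases (by simp) fun i => by simpa using dist_le_pi_dist z w i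
    have hint : ∀ F : ℝ → ℝ, Continuous F → Integrable F (μ 0) := fun F hF =>
      hF.integrable_of_ae_mem_isCompact isCompact_Icc ((hμ 0).mono fun t ht => abs_le.1 ht)
    have hig : ∀ z : Fin n → ℝ, Integrable (fun t => Real.exp (g (Fin.cons t z))) (μ 0) :=
      fun z => hint _ (Real.continuous_exp.comp (hg.continuous.comp (hL0 z)))
    have hih : ∀ z : Fin n → ℝ, Integrable (fun t => Real.exp (h (Fin.cons t z))) (μ 0) :=
      fun z => hint _ (Real.continuous_exp.comp (hhL.continuous.comp (hL0 z)))
    have hif : ∀ z : Fin n → ℝ, Integrable (fun t => Real.exp (-f (Fin.cons t z))) (μ 0) :=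
      fun z => hint _ (Real.continuous_exp.comp (hf.continuous.comp (hL0 z)).neg)
    have hcons : ∀ (a b : ℝ) (t s : ℝ) (z w : Fin n → ℝ),
        (Fin.cons (a * t + b * s) (a • z + b • w) : Fin (n + 1) → ℝ)
          = a • (Fin.cons t z : Fin (n + 1) → ℝ) + b • (Fin.cons s w : Fin (n + 1) → ℝ) := by
      intro a b t s z w
      ext i
      refine Fin.cases ?_ (fun j => ?_) i <;> simp
    have hshift : ∀ (t s : ℝ) (z : Fin n → ℝ),
        (Fin.cons t z : Fin (n + 1) → ℝ) + (s - t) • e = Fin.cons s z := by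
      intro t s z
      ext i
      refine Fin.cases ?_ (fun j => ?_) i <;> simp [he]
    -- The one-dimensional inequality in the first coordinate.
    have hone : ∀ z : Fin n → ℝ, (∫ t, Real.exp (h (Fin.cons t z)) ∂μ 0) *
        ∫ t, Real.exp (-f (Fin.cons t z)) ∂μ 0 ≤ 1 := by
      intro z
      refine integral_exp_mul_integral_exp_neg_le_one_real hγ0.le hγ (μ 0) (hμ 0)
        (f := fun t => f (Fin.cons t z)) (g := fun t => h (Fin.cons t z)) ?_ ?_ (hih z) (hif z)
      · refine ⟨convex_univ, fun t _ s _ a b ha hb hab => ?_⟩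
        have h1 := hc.2 (Set.mem_univ (Fin.cons t z)) (Set.mem_univ (Fin.cons s z)) ha hb hab
        rwa [← hcons, ← add_smul, hab, one_smul] at h1
      · intro t s
        have h1 := lineInfConv_le (e := e) hγ0 hf (Fin.cons t z) (s - t)
        rwa [hshift, ← neg_sub, neg_sq] at h1
    -- Log-integrating out the first coordinate keeps convexity (as `h` is jointly convex) and the
    -- relation between the two functions, so the induction hypothesis applies to `φ` and `G`.
    set φ : (Fin n → ℝ) → ℝ := fun z => Real.log (∫ t, Real.exp (h (Fin.cons t z)) ∂μ 0)
    set G : (Fin n → ℝ) → ℝ := fun z => Real.log (∫ t, Real.exp (g (Fin.cons t z)) ∂μ 0)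
    have hφc : ConvexOn ℝ Set.univ φ := by
      refine convexOn_log_integral_exp hih fun t => ⟨convex_univ, fun z _ w _ a b ha hb hab => ?_⟩
      have h1 := hhc.2 (Set.mem_univ (Fin.cons t z)) (Set.mem_univ (Fin.cons t w)) ha hb hab
      rwa [← hcons, ← add_mul, hab, one_mul] at h1
    have hφL : LipschitzWith (K * 1) φ :=
      lipschitzWith_log_integral_exp hih fun t => hhL.comp (hL1 t)
    have hGL : LipschitzWith (K' * 1) G :=
      lipschitzWith_log_integral_exp hig fun t => hg.comp (hL1 t)
    have hGφ : ∀ x z, G x ≤ φ z + γ * ∑ i, (x i - z i) ^ 2 := by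
      intro x z
      refine log_integral_exp_le (hig x) (hih z) fun t => ?_
      rw [← sub_le_iff_le_add]
      refine le_ciInf fun s => ?_
      have h1 := hgf (Fin.cons t x) (Fin.cons (t + s) z)
      rw [Fin.sum_univ_succ] at h1
      simp only [Fin.cons_zero, Fin.cons_succ] at h1
      have h2 := hshift t (t + s) z
      rw [add_sub_cancel_left] at h2
      rw [h2]
      linarith
    have key := ih (fun i => μ i.succ) (fun i => hμ i.succ) hφc hφL hGL hGφ
    have hIφ : Integrable (fun z => Real.exp (-φ z)) (Measure.pi fun i : Fin n => μ i.succ) :=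
      (Real.continuous_exp.comp hφL.continuous.neg).integrable_of_ae_mem_isCompact
        (isCompact_univ_pi fun _ => isCompact_Icc)
        (ae_pi_mem_pi_Icc _ fun i => hμ i.succ)
    obtain ⟨hg1, -⟩ := hcomm _ (Real.continuous_exp.comp hg.continuous)
    obtain ⟨hf1, hf2⟩ := hcomm _ (Real.continuous_exp.comp hf.continuous.neg)
    simp only [Function.comp_apply, Pi.neg_apply] at hg1 hf1 hf2
    have hGe : ∀ z, Real.exp (G z) = ∫ t, Real.exp (g (Fin.cons t z)) ∂μ 0 := fun z =>
      Real.exp_log (integral_exp_pos (hig z))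
    have hφe : ∀ z, ∫ t, Real.exp (-f (Fin.cons t z)) ∂μ 0 ≤ Real.exp (-φ z) := fun z => by
      rw [Real.exp_neg, Real.exp_log (integral_exp_pos (hih z)), ← one_div,
        le_div_iff₀ (integral_exp_pos (hih z)), mul_comm]
      exact hone z
    simp only [hGe] at key
    rw [hg1, hf1]
    refine le_trans (mul_le_mul_of_nonneg_left (integral_mono hf2 hIφ hφe) ?_) key
    exact integral_nonneg fun z => integral_nonneg fun t => (Real.exp_pos _).le

/-! ### Exponential concentration of convex functions -/

section Concentration

variable {m : ℕ} {Δ L : ℝ} {f : (Fin m → ℝ) → ℝ}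

theorem lipschitzWith_of_le_add_mul_sqrt_sum_sq (hL : 0 ≤ L)
    (hf : ∀ x z, f x ≤ f z + L * Real.sqrt (∑ j, (x j - z j) ^ 2)) :
    LipschitzWith (L * Real.sqrt m).toNNReal f := by
  refine LipschitzWith.of_le_add_mul _ fun x z => (hf x z).trans ?_
  rw [Real.coe_toNNReal _ (by positivity), mul_assoc]
  gcongr
  rw [← Real.sqrt_sq (dist_nonneg (x := x) (y := z)), ← Real.sqrt_mul (Nat.cast_nonneg m)]
  refine Real.sqrt_le_sqrt ?_
  calc ∑ j, (x j - z j) ^ 2 ≤ ∑ _j : Fin m, dist x z ^ 2 := Finset.sum_le_sum fun j _ => by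
        rw [← sq_abs, ← Real.dist_eq]
        exact pow_le_pow_left₀ dist_nonneg (dist_le_pi_dist x z j) 2
    _ = m * dist x z ^ 2 := by simp

variable {ν : Fin m → Measure ℝ} [∀ i, IsProbabilityMeasure (ν i)]

theorem integrable_pi_of_continuous (hν : ∀ i, ∀ᵐ t ∂ν i, |t| ≤ Δ) {g : (Fin m → ℝ) → ℝ}
    (hg : Continuous g) : Integrable g (Measure.pi ν) :=
  hg.integrable_of_ae_mem_isCompact (isCompact_univ_pi fun _ => isCompact_Icc)
    (ae_pi_mem_pi_Icc ν hν)

/-- The moment generating functions at `λ` and `-λ` of a convex, Euclidean-Lipschitz function are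
controlled together. The `8 λ² L² Δ²` is the most that `λ f` can drop under infimal convolution
with the cost `|x - z|² / (32 Δ²)`. -/
theorem mgf_mul_mgf_neg_le (hΔ : 0 < Δ) (hν : ∀ i, ∀ᵐ t ∂ν i, |t| ≤ Δ) (hL : 0 ≤ L)
    (hc : ConvexOn ℝ Set.univ f)
    (hf : ∀ x z, f x ≤ f z + L * Real.sqrt (∑ j, (x j - z j) ^ 2)) {l : ℝ} (hl : 0 ≤ l) :
    mgf f (Measure.pi ν) l * mgf f (Measure.pi ν) (-l) ≤ Real.exp (8 * l ^ 2 * L ^ 2 * Δ ^ 2) := by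
  have hLip := lipschitzWith_of_le_add_mul_sqrt_sum_sq hL hf
  have hlf : LipschitzWith (l.toNNReal * (L * Real.sqrt m).toNNReal) fun x => l * f x := by
    refine LipschitzWith.of_le_add_mul _ fun x z => ?_
    rw [NNReal.coe_mul, Real.coe_toNNReal l hl, mul_assoc, ← mul_add]
    exact mul_le_mul_of_nonneg_left (hLip.le_add_mul x z) hl
  have hlg : LipschitzWith (l.toNNReal * (L * Real.sqrt m).toNNReal)
      fun x => l * f x - 8 * l ^ 2 * L ^ 2 * Δ ^ 2 := by
    refine LipschitzWith.of_le_add_mul _ fun x z => ?_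
    linarith [hlf.le_add_mul x z]
  have key := integral_exp_mul_integral_exp_neg_le_one (γ := 1 / (32 * Δ ^ 2)) (Δ := Δ)
    (by positivity) (le_of_eq (by field_simp; norm_num)) m ν hν (hc.smul hl) hlf hlg ?_
  · simp only [Real.exp_sub] at key
    rw [integral_div, div_mul_eq_mul_div, div_le_one (Real.exp_pos _)] at key
    simpa only [mgf, neg_mul, smul_eq_mul] using key
  · intro x z
    have hs : 0 ≤ ∑ j, (x j - z j) ^ 2 := Finset.sum_nonneg fun j _ => sq_nonneg _
    set r := Real.sqrt (∑ j, (x j - z j) ^ 2) with hr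
    rw [← Real.sq_sqrt hs, ← hr]
    have h1 := mul_le_mul_of_nonneg_left (hf x z) hl
    have h2 : 1 / (32 * Δ ^ 2) * r ^ 2 + 8 * l ^ 2 * L ^ 2 * Δ ^ 2 - l * (L * r)
        = (r - 16 * Δ ^ 2 * l * L) ^ 2 / (32 * Δ ^ 2) := by field_simp; ring
    have h3 : 0 ≤ (r - 16 * Δ ^ 2 * l * L) ^ 2 / (32 * Δ ^ 2) := by positivity
    simp only [smul_eq_mul]
    linarith

/-- Jensen's inequality for the exponential. -/
theorem exp_mul_integral_le_mgf {α : Type*} [MeasurableSpace α] {μ : Measure α}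
    [IsProbabilityMeasure μ] {X : α → ℝ} (l : ℝ) (hX : Integrable X μ)
    (he : Integrable (fun x => Real.exp (l * X x)) μ) :
    Real.exp (l * ∫ x, X x ∂μ) ≤ mgf X μ l := by
  rw [← integral_const_mul]
  exact convexOn_exp.map_integral_le Real.continuous_exp.continuousOn isClosed_univ
    (Filter.Eventually.of_forall fun _ => Set.mem_univ _) (hX.const_mul l) he

/-- Jensen's inequality bounds one of the two factors in `mgf_mul_mgf_neg_le`, which leaves a
sub-Gaussian bound on the other; this is where upper and lower tails are obtained at once. -/
theorem mgf_le_exp (hΔ : 0 < Δ) (hν : ∀ i, ∀ᵐ t ∂ν i, |t| ≤ Δ) (hL : 0 ≤ L)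
    (hc : ConvexOn ℝ Set.univ f)
    (hf : ∀ x z, f x ≤ f z + L * Real.sqrt (∑ j, (x j - z j) ^ 2)) (l : ℝ) :
    mgf f (Measure.pi ν) l
      ≤ Real.exp (l * (∫ x, f x ∂Measure.pi ν) + 8 * l ^ 2 * L ^ 2 * Δ ^ 2) := by
  have hcont := (lipschitzWith_of_le_add_mul_sqrt_sum_sq hL hf).continuous
  have hprod : mgf f (Measure.pi ν) l * mgf f (Measure.pi ν) (-l)
      ≤ Real.exp (8 * l ^ 2 * L ^ 2 * Δ ^ 2) := by
    rcases le_total 0 l with hl | hl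
    · exact mgf_mul_mgf_neg_le hΔ hν hL hc hf hl
    · have := mgf_mul_mgf_neg_le hΔ hν hL hc hf (neg_nonneg.2 hl)
      rwa [neg_neg, neg_sq, mul_comm] at this
  have hJ := exp_mul_integral_le_mgf (-l) (integrable_pi_of_continuous hν hcont)
    (integrable_pi_of_continuous hν (by fun_prop))
  have h1 := (mul_le_mul_of_nonneg_left hJ mgf_nonneg).trans hprod
  rw [neg_mul, Real.exp_neg, ← div_eq_mul_inv, div_le_iff₀ (Real.exp_pos _), ← Real.exp_add] at h1
  rwa [add_comm]

/-- Both tails of a convex function with Euclidean Lipschitz constant `L` around its mean, by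
Chernoff's bound. -/
theorem measureReal_tails_le_of_convexOn (hΔ : 0 < Δ) (hν : ∀ i, ∀ᵐ t ∂ν i, |t| ≤ Δ)
    (hL : 0 ≤ L) (hc : ConvexOn ℝ Set.univ f)
    (hf : ∀ x z, f x ≤ f z + L * Real.sqrt (∑ j, (x j - z j) ^ 2)) {β : ℝ} (hβ : 0 < β) :
    (Measure.pi ν).real {x | (∫ x, f x ∂Measure.pi ν) + β * L < f x}
      ≤ Real.exp (-(β ^ 2 / (32 * Δ ^ 2))) ∧
    (Measure.pi ν).real {x | f x < (∫ x, f x ∂Measure.pi ν) - β * L}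
      ≤ Real.exp (-(β ^ 2 / (32 * Δ ^ 2))) := by
  have hcont := (lipschitzWith_of_le_add_mul_sqrt_sum_sq hL hf).continuous
  rcases hL.eq_or_lt with rfl | hL0
  · -- For `L = 0` the function is constant, so both events are empty.
    have hconst : f = fun _ => f 0 := by
      funext x
      have h1 := hf x 0
      have h2 := hf 0 x
      rw [zero_mul, add_zero] at h1 h2
      exact le_antisymm h1 h2
    rw [hconst]
    simp [Real.exp_nonneg]
  -- The Chernoff exponent `8 l² L² Δ² - l β L` is smallest at this `l`.
  set l := β / (16 * L * Δ ^ 2) with hl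
  have hl0 : 0 ≤ l := by positivity
  have hexp : 8 * l ^ 2 * L ^ 2 * Δ ^ 2 - l * (β * L) = -(β ^ 2 / (32 * Δ ^ 2)) := by
    rw [hl]; field_simp; norm_num
  have hint : ∀ l : ℝ, Integrable (fun x => Real.exp (l * f x)) (Measure.pi ν) := fun l =>
    integrable_pi_of_continuous hν (by fun_prop)
  set E := ∫ x, f x ∂Measure.pi ν
  constructor
  · have hsub := measureReal_mono (μ := Measure.pi ν) (s₁ := {x | E + β * L < f x})
      (s₂ := {x | E + β * L ≤ f x}) fun x hx => le_of_lt (Set.mem_ofPred.1 hx)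
    refine hsub.trans ((measure_ge_le_exp_mul_mgf (E + β * L) hl0 (hint l)).trans ?_)
    refine (mul_le_mul_of_nonneg_left (mgf_le_exp hΔ hν hL hc hf l) (Real.exp_pos _).le).trans_eq ?_
    rw [← Real.exp_add, ← hexp]
    congr 1
    ring
  · have hsub := measureReal_mono (μ := Measure.pi ν) (s₁ := {x | f x < E - β * L})
      (s₂ := {x | f x ≤ E - β * L}) fun x hx => le_of_lt (Set.mem_ofPred.1 hx)
    refine hsub.trans
      ((measure_le_le_exp_mul_mgf (E - β * L) (neg_nonpos.2 hl0) (hint (-l))).trans ?_)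
    refine (mul_le_mul_of_nonneg_left (mgf_le_exp hΔ hν hL hc hf (-l))
      (Real.exp_pos _).le).trans_eq ?_
    rw [← Real.exp_add, ← hexp]
    congr 1
    ring

end Concentration

/-! ### The two norms and their Lipschitz constants -/

section Norms

variable {n m : ℕ}

theorem le_topNorm {k : ℕ} (x : Fin n → ℝ) {S : Finset (Fin n)} (hS : S.card ≤ k) :
    ∑ i ∈ S, |x i| ≤ topNorm k x :=
  le_ciSup (f := fun S : {S : Finset (Fin n) // S.card ≤ k} => ∑ i ∈ S.1, |x i|)
    (Set.finite_range _).bddAbove ⟨S, hS⟩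

theorem topNorm_le {k : ℕ} {x : Fin n → ℝ} {C : ℝ}
    (h : ∀ S : Finset (Fin n), S.card ≤ k → ∑ i ∈ S, |x i| ≤ C) : topNorm k x ≤ C :=
  have : Nonempty {S : Finset (Fin n) // S.card ≤ k} := ⟨⟨∅, by simp⟩⟩
  ciSup_le fun S => h S.1 S.2

/-- `‖·‖_{k,1}` as a seminorm. -/
noncomputable def topSeminorm (n k : ℕ) : Seminorm ℝ (Fin n → ℝ) :=
  Seminorm.ofSMulLE (topNorm k)
    (le_antisymm (topNorm_le fun S _ => by simp)
      (by simpa using le_topNorm 0 (S := (∅ : Finset (Fin n))) (k := k) (by simp)))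
    (fun x y => topNorm_le fun S hS => by
      refine le_trans ?_ (add_le_add (le_topNorm x hS) (le_topNorm y hS))
      rw [← Finset.sum_add_distrib]
      exact Finset.sum_le_sum fun i _ => abs_add_le _ _)
    (fun r x => topNorm_le fun S hS => by
      simp only [Pi.smul_apply, smul_eq_mul, abs_mul, ← Finset.mul_sum]
      exact mul_le_mul_of_nonneg_left (le_topNorm x hS) (abs_nonneg r))

/-- `‖·‖₁` as a seminorm. -/
noncomputable def l1Seminorm (n : ℕ) : Seminorm ℝ (Fin n → ℝ) :=
  Seminorm.of l1Norm
    (fun x y => by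
      simp only [l1Norm, ← Finset.sum_add_distrib]
      exact Finset.sum_le_sum fun i _ => abs_add_le _ _)
    (fun r x => by simp [l1Norm, abs_mul, Finset.mul_sum])

theorem dotProduct_mulVec_le_sqrt_mul_sqrt (F : Matrix (Fin n) (Fin m) ℝ) (w : Fin n → ℝ)
    (d : Fin m → ℝ) :
    w ⬝ᵥ (F *ᵥ d) ≤ Real.sqrt (w ⬝ᵥ ((F * Fᵀ) *ᵥ w)) * Real.sqrt (∑ j, d j ^ 2) := by
  rw [Matrix.dotProduct_mulVec, ← Matrix.mulVec_mulVec, Matrix.dotProduct_mulVec,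
    Matrix.mulVec_transpose]
  simpa only [dotProduct, ← sq] using Real.sum_mul_le_sqrt_mul_sqrt Finset.univ (w ᵥ* F) d

theorem dotProduct_kronecker_mulVec (G : Matrix (Fin n) (Fin n) ℝ) (u : Fin 2 × Fin n → ℝ) :
    u ⬝ᵥ ((!![(1 : ℝ), -1; -1, 1] ⊗ₖ G) *ᵥ u)
      = (fun i => u (0, i) - u (1, i)) ⬝ᵥ (G *ᵥ fun i => u (0, i) - u (1, i)) := by
  simp only [dotProduct, Matrix.mulVec, Fintype.sum_prod_type, Fin.sum_univ_two,
    Matrix.kroneckerMap_apply, Matrix.of_apply, Matrix.cons_val', Matrix.cons_val_zero,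
    Matrix.cons_val_one, Matrix.cons_val_fin_one, ← Finset.sum_add_distrib, Finset.mul_sum]
  refine Finset.sum_congr rfl fun i _ => Finset.sum_congr rfl fun j _ => ?_
  ring

theorem bddAbove_sigmaValues (k : ℕ) (F : Matrix (Fin n) (Fin m) ℝ) :
    BddAbove (sigmaValues k F) := by
  have hfin : {u : Fin 2 × Fin n → ℝ | ∀ p, u p = 0 ∨ u p = 1}.Finite := by
    refine (Set.Finite.pi' fun _ => Set.toFinite ({0, 1} : Set ℝ)).subset fun u hu p => ?_
    simpa using hu p
  refine ((hfin.image fun u => u ⬝ᵥ ((!![(1 : ℝ), -1; -1, 1] ⊗ₖ (F * Fᵀ)) *ᵥ u)).subset ?_).bddAbove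
  rintro q ⟨u, hu, -, rfl⟩
  exact ⟨u, hu, rfl⟩

theorem bddAbove_cutValues (F : Matrix (Fin n) (Fin m) ℝ) : BddAbove (cutValues F) := by
  have hfin : {v : Fin n → ℝ | ∀ i, v i = -1 ∨ v i = 1}.Finite := by
    refine (Set.Finite.pi' fun _ => Set.toFinite ({-1, 1} : Set ℝ)).subset fun v hv i => ?_
    simpa using hv i
  refine ((hfin.image fun v => v ⬝ᵥ ((F * Fᵀ) *ᵥ v)).subset ?_).bddAbove
  rintro q ⟨v, hv, rfl⟩
  exact ⟨v, hv, rfl⟩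

/-- `σ_k(F)` is a Euclidean Lipschitz constant of `‖F ·‖_{k,1}`: a sign vector supported on at most
`k` indices is the difference of the halves of a vector admissible in the definition of `σ_k`. -/
theorem topNorm_mulVec_le (k : ℕ) (F : Matrix (Fin n) (Fin m) ℝ) (d : Fin m → ℝ) :
    topNorm k (F *ᵥ d) ≤ sigma k F * Real.sqrt (∑ j, d j ^ 2) := by
  refine topNorm_le fun S hS => ?_
  -- `u` is the indicator of the nonnegative entries indexed by `S`, followed by that of the
  -- negative ones, so that the difference of its halves is the sign vector of `F d` on `S`.
  set u : Fin 2 × Fin n → ℝ := fun p =>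
    if p.2 ∈ S then
      if p.1 = 0 then (if 0 ≤ (F *ᵥ d) p.2 then 1 else 0)
      else (if 0 ≤ (F *ᵥ d) p.2 then 0 else 1)
    else 0 with hu
  have hmem : u ⬝ᵥ ((!![(1 : ℝ), -1; -1, 1] ⊗ₖ (F * Fᵀ)) *ᵥ u) ∈ sigmaValues k F := by
    refine ⟨u, fun p => ?_, ?_, rfl⟩
    · simp only [hu]
      split_ifs <;> simp
    · have : ∑ p, u p = S.card := by
        have hpair : ∀ i, u (0, i) + u (1, i) = if i ∈ S then 1 else 0 := fun i => by
          simp only [hu]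
          split_ifs <;> simp_all
        rw [Fintype.sum_prod_type, Fin.sum_univ_two, ← Finset.sum_add_distrib]
        simp [hpair]
      rw [this]
      exact_mod_cast hS
  have hval := le_csSup (bddAbove_sigmaValues k F) hmem
  rw [dotProduct_kronecker_mulVec] at hval
  have hsum : ∑ i ∈ S, |(F *ᵥ d) i| = (fun i => u (0, i) - u (1, i)) ⬝ᵥ (F *ᵥ d) := by
    rw [dotProduct, ← Finset.sum_subset (Finset.subset_univ S)]
    · refine Finset.sum_congr rfl fun i hi => ?_
      by_cases h : 0 ≤ (F *ᵥ d) i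
      · simp [hu, hi, h, abs_of_nonneg h]
      · simp [hu, hi, h, abs_of_neg (not_le.1 h)]
    · intro i _ hi
      simp [hu, hi]
  rw [hsum]
  exact (dotProduct_mulVec_le_sqrt_mul_sqrt F _ d).trans
    (mul_le_mul_of_nonneg_right (Real.sqrt_le_sqrt hval) (Real.sqrt_nonneg _))

/-- `L(F)` is a Euclidean Lipschitz constant of `‖F ·‖₁`. -/
theorem l1Norm_mulVec_le (F : Matrix (Fin n) (Fin m) ℝ) (d : Fin m → ℝ) :
    l1Norm (F *ᵥ d) ≤ cutConst F * Real.sqrt (∑ j, d j ^ 2) := by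
  set v : Fin n → ℝ := fun i => if 0 ≤ (F *ᵥ d) i then 1 else -1 with hv
  have hmem : v ⬝ᵥ ((F * Fᵀ) *ᵥ v) ∈ cutValues F := by
    refine ⟨v, fun i => ?_, rfl⟩
    simp only [hv]
    split_ifs <;> simp
  have hsum : l1Norm (F *ᵥ d) = v ⬝ᵥ (F *ᵥ d) := by
    refine Finset.sum_congr rfl fun i _ => ?_
    by_cases h : 0 ≤ (F *ᵥ d) i
    · simp [hv, h, abs_of_nonneg h]
    · simp [hv, h, abs_of_neg (not_le.1 h)]
  rw [hsum]
  exact (dotProduct_mulVec_le_sqrt_mul_sqrt F _ d).trans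
    (mul_le_mul_of_nonneg_right (Real.sqrt_le_sqrt (le_csSup (bddAbove_cutValues F) hmem))
      (Real.sqrt_nonneg _))

/-! ### Tails of seminorms of `F y` -/

/-- Both tails for a seminorm `p` of `F y`, where `y` has independent coordinates bounded by `Δ`
and `L` is a Lipschitz constant of `p ∘ F` for the Euclidean norm. -/
theorem measureReal_seminorm_mulVec_tails {Ω : Type*} [MeasurableSpace Ω] {μ : Measure Ω}
    [IsProbabilityMeasure μ] {y : Ω → Fin m → ℝ} (hy : Measurable y)
    (hind : iIndepFun (fun (j : Fin m) (ω : Ω) => y ω j) μ) {β Δ L : ℝ} (hβ : 0 < β) (hΔ : 0 < Δ)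
    (hbd : ∀ᵐ ω ∂μ, ∀ j, |y ω j| ≤ Δ) (hL : 0 ≤ L) (p : Seminorm ℝ (Fin n → ℝ))
    (F : Matrix (Fin n) (Fin m) ℝ) (hp : ∀ d, p (F *ᵥ d) ≤ L * Real.sqrt (∑ j, d j ^ 2)) :
    μ.real {ω | (∫ ω, p (F *ᵥ y ω) ∂μ) + β * L < p (F *ᵥ y ω)}
      ≤ Real.exp (-(β ^ 2 / (32 * Δ ^ 2))) ∧
    μ.real {ω | p (F *ᵥ y ω) < (∫ ω, p (F *ᵥ y ω) ∂μ) - β * L}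
      ≤ Real.exp (-(β ^ 2 / (32 * Δ ^ 2))) := by
  have hyj : ∀ j, Measurable fun ω => y ω j := fun j => (measurable_pi_apply j).comp hy
  have hlaw : μ.map y = Measure.pi fun j => μ.map fun ω => y ω j :=
    (iIndepFun_iff_map_fun_eq_pi_map fun j => (hyj j).aemeasurable).1 hind
  have : ∀ j, IsProbabilityMeasure (μ.map fun ω => y ω j) := fun j =>
    Measure.isProbabilityMeasure_map (hyj j).aemeasurable
  have hν : ∀ j, ∀ᵐ t ∂μ.map (fun ω => y ω j), |t| ≤ Δ := fun j =>
    (ae_map_iff (hyj j).aemeasurable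
      (measurableSet_le continuous_abs.measurable measurable_const)).2 (hbd.mono fun ω h => h j)
  set f : (Fin m → ℝ) → ℝ := fun x => p (F *ᵥ x)
  have hc : ConvexOn ℝ Set.univ f := (p.comp F.mulVecLin).convexOn
  have hlip : ∀ x z, f x ≤ f z + L * Real.sqrt (∑ j, (x j - z j) ^ 2) := fun x z => by
    have h1 := map_add_le_add p (F *ᵥ z) (F *ᵥ (x - z))
    rw [← Matrix.mulVec_add, add_sub_cancel] at h1
    exact h1.trans (add_le_add_right (hp (x - z)) _)
  have hm : Measurable f := (lipschitzWith_of_le_add_mul_sqrt_sum_sq hL hlip).continuous.measurable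
  have key := measureReal_tails_le_of_convexOn hΔ hν hL hc hlip hβ
  rw [← hlaw, integral_map hy.aemeasurable hm.aestronglyMeasurable,
    map_measureReal_apply hy (measurableSet_lt measurable_const hm),
    map_measureReal_apply hy (measurableSet_lt hm measurable_const)] at key
  exact key

end Norms

/-! ### The comparison of the two norms -/

theorem mainTheorem4 :
    ∃ c : ℝ, 0 < c ∧
      ∀ (n m k : ℕ) (F : Matrix (Fin n) (Fin m) ℝ) (α β Δ : ℝ),
        0 ≤ α → 0 < β → 0 < Δ →
      ∀ (Ω : Type*) [MeasurableSpace Ω] (μ : Measure Ω) [IsProbabilityMeasure μ]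
        (y : Ω → Fin m → ℝ),
        Measurable y →
        iIndepFun (fun (j : Fin m) (ω : Ω) => y ω j) μ →
        (∀ᵐ ω ∂μ, ∀ j, |y ω j| ≤ Δ) →
        (∫ ω, topNorm k (F *ᵥ y ω) ∂μ) + β * sigma k F
          ≤ ((∫ ω, l1Norm (F *ᵥ y ω) ∂μ) - β * cutConst F) * α →
        1 - 2 * c * Real.exp (-(β ^ 2 / (c * Δ ^ 2)))
          ≤ μ.real {ω | topNorm k (F *ᵥ y ω) ≤ α * l1Norm (F *ᵥ y ω)} := by
  refine ⟨32, by norm_num, fun n m k F α β Δ hα hβ hΔ Ω _ μ _ y hy hind hbd hmain => ?_⟩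
  have h1 := (measureReal_seminorm_mulVec_tails hy hind hβ hΔ hbd (Real.sqrt_nonneg _)
    (topSeminorm n k) F (topNorm_mulVec_le k F)).1
  have h2 := (measureReal_seminorm_mulVec_tails hy hind hβ hΔ hbd (Real.sqrt_nonneg _)
    (l1Seminorm n) F (l1Norm_mulVec_le F)).2
  change μ.real {ω | (∫ ω, topNorm k (F *ᵥ y ω) ∂μ) + β * sigma k F < topNorm k (F *ᵥ y ω)} ≤ _
    at h1
  change μ.real {ω | l1Norm (F *ᵥ y ω) < (∫ ω, l1Norm (F *ᵥ y ω) ∂μ) - β * cutConst F} ≤ _ at h2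
  set A := {ω | topNorm k (F *ᵥ y ω) ≤ α * l1Norm (F *ᵥ y ω)}
  set B := {ω | (∫ ω, topNorm k (F *ᵥ y ω) ∂μ) + β * sigma k F < topNorm k (F *ᵥ y ω)}
  set C := {ω | l1Norm (F *ᵥ y ω) < (∫ ω, l1Norm (F *ᵥ y ω) ∂μ) - β * cutConst F}
  -- Outside both deviation events the hypothesis gives the inequality deterministically.
  have hcover : (Set.univ : Set Ω) ⊆ A ∪ (B ∪ C) := fun ω _ => by
    by_contra hω
    simp only [Set.mem_union, not_or] at hω
    obtain ⟨hA, hB, hC⟩ := hω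
    have hB' : topNorm k (F *ᵥ y ω) ≤ _ := le_of_not_gt hB
    have hle : _ ≤ l1Norm (F *ᵥ y ω) := le_of_not_gt hC
    have hC' := mul_le_mul_of_nonneg_right hle hα
    exact hA (show topNorm k (F *ᵥ y ω) ≤ α * l1Norm (F *ᵥ y ω) by linarith)
  have h3 := measureReal_mono (μ := μ) hcover
  rw [probReal_univ] at h3
  have h4 := measureReal_union_le (μ := μ) A (B ∪ C)
  have h5 := measureReal_union_le (μ := μ) B C
  have h6 := Real.exp_pos (-(β ^ 2 / (32 * Δ ^ 2)))
  linarith
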